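/- Let $F$ be a field with $\operatorname{char}(F)\neq 2,3$ and let $A$ be a finite-dimensional associative algebra over $F$, not necessarily unital. Let $[A,A]$ denote the linear span of all commutators $xy-yx$ with $x,y\in A$, and let $\operatorname{rad}(A)$ denote the radical of $A$, that is, the unique maximal nilpotent two-sided ideal of $A$. Let $T:A\to A$ be an $F$-linear map such that $T(x)^3-x^3\in[A,A]$ for every $x\in A$. Then $T(x^4)-T(x)^4\in\operatorname{rad}(A)$ for every $x\in A$. Moreover, if $A$ is unital and $T(1)=1$, then $T(x^2)-T(x)^2\in\operatorname{rad}(A)$ for every $x\in A$. -/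

import Mathlib

/-! Algebras over a field `F` are associative but not assumed to be unital: `NonUnitalRing A` with
`Module F A`, `IsScalarTower F A A` and `SMulCommClass F A A`. -/

namespace FinDimAlg

variable (F : Type*) {A : Type*} [Field F] [NonUnitalRing A] [Module F A]

/-- `[A, A]`: the linear span of all commutators in `A`. -/
def commutatorSpace (A : Type*) [NonUnitalRing A] [Module F A] : Submodule F A :=
  Submodule.span F {z : A | ∃ x y : A, z = x * y - y * x}

variable {F}

/-- A linear subspace of `A` that is a two-sided ideal. -/
def IsIdeal (I : Submodule F A) : Prop :=
  ∀ a : A, ∀ x ∈ I, a * x ∈ I ∧ x * a ∈ I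

/-- The product `I J`: the linear span of all `x * y` with `x ∈ I` and `y ∈ J`. -/
def idealMul (I J : Submodule F A) : Submodule F A :=
  Submodule.span F {z : A | ∃ x ∈ I, ∃ y ∈ J, z = x * y}

/-- `powSucc I n` is the power `I ^ (n + 1)`. -/
def powSucc (I : Submodule F A) : ℕ → Submodule F A
  | 0 => I
  | n + 1 => idealMul (powSucc I n) I

/-- A nilpotent ideal: a two-sided ideal some positive power of which is zero. -/
def IsNilpotentIdeal (I : Submodule F A) : Prop :=
  IsIdeal I ∧ ∃ n : ℕ, powSucc I n = ⊥

variable (F)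

/-- The radical `rad(A)`: the sum of all nilpotent ideals of `A`. In a finite-dimensional algebra
it is the unique maximal nilpotent ideal, see `isGreatest_rad`. -/
def rad (A : Type*) [NonUnitalRing A] [Module F A] : Submodule F A :=
  sSup {I : Submodule F A | IsNilpotentIdeal I}

variable {F}

theorem idealMul_le {I J K : Submodule F A} :
    idealMul I J ≤ K ↔ ∀ x ∈ I, ∀ y ∈ J, x * y ∈ K := by
  rw [idealMul, Submodule.span_le]
  constructor
  · intro h x hx y hy
    exact h ⟨x, hx, y, hy, rfl⟩
  · rintro h _ ⟨x, hx, y, hy, rfl⟩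
    exact h x hx y hy

theorem mul_mem_idealMul {I J : Submodule F A} {x y : A} (hx : x ∈ I) (hy : y ∈ J) :
    x * y ∈ idealMul I J :=
  idealMul_le.1 le_rfl x hx y hy

theorem idealMul_mono {I J I' J' : Submodule F A} (h : I ≤ I') (h' : J ≤ J') :
    idealMul I J ≤ idealMul I' J' :=
  idealMul_le.2 fun _ hx _ hy => mul_mem_idealMul (h hx) (h' hy)

theorem IsIdeal.sup {I J : Submodule F A} (hI : IsIdeal I) (hJ : IsIdeal J) :
    IsIdeal (I ⊔ J) := by
  intro a x hx
  obtain ⟨i, hi, j, hj, rfl⟩ := Submodule.mem_sup.1 hx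
  rw [mul_add, add_mul]
  exact ⟨Submodule.add_mem_sup (hI a i hi).1 (hJ a j hj).1,
    Submodule.add_mem_sup (hI a i hi).2 (hJ a j hj).2⟩

theorem powSucc_sup_le {I J : Submodule F A} (hJ : IsIdeal J) (n : ℕ) :
    powSucc (I ⊔ J) n ≤ powSucc I n ⊔ J := by
  induction n with
  | zero => exact le_rfl
  | succ n ih =>
    refine idealMul_le.2 fun x hx y hy => ?_
    obtain ⟨p, hp, q, hq, rfl⟩ := Submodule.mem_sup.1 (ih hx)
    obtain ⟨i, hi, j, hj, rfl⟩ := Submodule.mem_sup.1 hy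
    have h : (p + q) * (i + j) = p * i + (p * j + q * (i + j)) := by
      rw [mul_add, add_mul, add_mul, mul_add]; abel
    rw [h]
    exact Submodule.add_mem_sup (mul_mem_idealMul hp hi)
      (J.add_mem (hJ p j hj).1 (hJ (i + j) q hq).2)

section

variable [IsScalarTower F A A] [SMulCommClass F A A]

theorem idealMul_assoc_le (I J K : Submodule F A) :
    idealMul (idealMul I J) K ≤ idealMul I (idealMul J K) := by
  refine idealMul_le.2 fun x hx y hy => ?_
  have h : idealMul I J ≤
      (idealMul I (idealMul J K)).comap (LinearMap.mulRight F y) := by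
    refine idealMul_le.2 fun u hu v hv => ?_
    rw [Submodule.mem_comap, LinearMap.mulRight_apply, mul_assoc]
    exact mul_mem_idealMul hu (mul_mem_idealMul hv hy)
  exact h hx

theorem powSucc_add_le (I : Submodule F A) (a b : ℕ) :
    powSucc I (a + b + 1) ≤ idealMul (powSucc I a) (powSucc I b) := by
  induction b with
  | zero => exact le_rfl
  | succ b ih => exact (idealMul_mono ih le_rfl).trans (idealMul_assoc_le _ _ _)

theorem IsNilpotentIdeal.sup {I J : Submodule F A} (hI : IsNilpotentIdeal I)
    (hJ : IsNilpotentIdeal J) : IsNilpotentIdeal (I ⊔ J) := by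
  obtain ⟨hI, m, hm⟩ := hI
  obtain ⟨hJ, n, hn⟩ := hJ
  have h1 : powSucc (I ⊔ J) m ≤ J := by
    simpa [hm] using powSucc_sup_le (I := I) hJ m
  have h2 : ∀ k : ℕ, ∃ N, powSucc (I ⊔ J) N ≤ powSucc J k := by
    intro k
    induction k with
    | zero => exact ⟨m, h1⟩
    | succ k ih =>
      obtain ⟨N, hN⟩ := ih
      exact ⟨N + m + 1, (powSucc_add_le _ N m).trans (idealMul_mono hN h1)⟩
  obtain ⟨N, hN⟩ := h2 n
  exact ⟨hI.sup hJ, N, le_bot_iff.1 (hN.trans hn.le)⟩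

theorem isNilpotentIdeal_bot : IsNilpotentIdeal (⊥ : Submodule F A) := by
  refine ⟨fun a x hx => ?_, 0, rfl⟩
  rw [Submodule.mem_bot] at hx
  simp [hx]

/-- In a finite-dimensional algebra, `rad(A)` is the unique maximal nilpotent ideal. -/
theorem isGreatest_rad [FiniteDimensional F A] :
    IsGreatest {I : Submodule F A | IsNilpotentIdeal I} (rad F A) := by
  refine ⟨?_, fun I hI => le_sSup hI⟩
  exact CompleteLattice.WellFoundedGT.isSupClosedCompact (Submodule F A) inferInstance _
    ⟨⊥, isNilpotentIdeal_bot⟩ (fun I hI J hJ => hI.sup hJ)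

end

end FinDimAlg

namespace FinDimAlg

/-! ### Twisted Jordan maps on a unital algebra -/

section TwistedJordan

variable {K B : Type*} [Field K] [Ring B] [Algebra K B]

/-! Polarizing the cubic condition gives `T x (T y T z + T z T y) ≡ x (y z + z y)` modulo
commutators, since 3 is invertible. This multilinear form survives extension of scalars to the
algebraic closure. There the quotient by the radical is a product of matrix algebras, where
commutators have trace zero in each block. Nondegeneracy of the trace makes `T` descend to a
bijection of this product preserving the cubic trace form (`exists_descent`), hence to a twisted
Jordan map.

The main point is that `a = T 1` is scalar in each block. With `T u = 1`, Jordan identities in `u`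
give `(ad a)^4 = 0` (`ad_pow_four`), so blockwise `a = c + N` with `N² = 0`
(`exists_sub_scalar_mul_self_eq_zero`). After division by `c`, computing the image of a fourth power
in two ways forces `N = 0` (`pow_four_mul_eq_zero`).

Thus `T = c J` blockwise with `J` a unital Jordan map. Comparing traces of minimal idempotents gives
`c³ = 1`, whence `T(x⁴) = c J(x)⁴ = c⁴ J(x)⁴ = T(x)⁴`. If `T 1 = 1`, squares are preserved at once.
-/

theorem eq_of_nsmul_eq (n : ℕ) (hn : (n : K) ≠ 0) {x y : B} (h : n • x = n • y) : x = y := by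
  rw [← Nat.cast_smul_eq_nsmul K, ← Nat.cast_smul_eq_nsmul K] at h
  exact smul_right_injective B hn h

/-- A linear map `T` with `T (x ^ 2) ∘ T 1 = T x ^ 2`, in linearized form, where `∘` is the
Jordan product. -/
def IsTwistedJordan (T : B →ₗ[K] B) : Prop :=
  ∀ y z, T (y * z + z * y) * T 1 + T 1 * T (y * z + z * y) = 2 • (T y * T z + T z * T y)

namespace IsTwistedJordan

variable {T : B →ₗ[K] B}

theorem commute_mul (hT : IsTwistedJordan T) (h2 : (2 : K) ≠ 0) {y z : B} (h : Commute y z) :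
    T (y * z) * T 1 + T 1 * T (y * z) = T y * T z + T z * T y := by
  have := hT y z
  rw [← h.eq, ← two_nsmul, map_nsmul] at this
  refine eq_of_nsmul_eq (K := K) 2 (by exact_mod_cast h2) ?_
  rw [← this]
  noncomm_ring

/-- Splitting `u⁴` as `u · u³` and as `u² · u²` gives two expressions for the same anticommutator
with `T 1`; comparing them yields the formula for `T(u³)`. -/
theorem exists_inverse (hT : IsTwistedJordan T) (h2 : (2 : K) ≠ 0) {u : B} (hu : T u = 1) :
    T (u * u) * T 1 = 1 ∧ T 1 * T (u * u) = 1 ∧ T (u * (u * u)) = T (u * u) * T (u * u) := by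
  have hc : Commute u (u * u) := (Commute.refl u).mul_right (Commute.refl u)
  have e1 := hT.commute_mul h2 (Commute.refl u)
  have e2 := hT.commute_mul h2 hc
  have e3 := hT.commute_mul h2 ((Commute.refl u).mul_right hc)
  have e4 := hT.commute_mul h2 (hc.mul_left hc)
  have h22 : ((2 : ℕ) : K) ≠ 0 := by exact_mod_cast h2
  rw [hu] at e1 e2 e3
  rw [show u * (u * (u * u)) = u * u * (u * u) by noncomm_ring] at e3
  generalize T 1 = a at *
  generalize T (u * u) = c at *
  generalize T (u * (u * u)) = t at *
  rw [e4] at e3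
  have ht : t = c * c := eq_of_nsmul_eq (K := K) 2 h22 (by
    rw [two_nsmul, two_nsmul]; simpa using e3.symm)
  rw [ht] at e2
  simp only [one_mul, mul_one] at e1 e2
  -- The anticommutator of `a` and `c` is the scalar 2, so it commutes with `c`.
  have k1 : a * (c * c) = (c * c) * a := by
    have : (c * a + a * c) * c - c * (c * a + a * c) = 0 := by rw [e1]; noncomm_ring
    rw [← sub_eq_zero, ← this]; noncomm_ring
  have k2 : c * c * a = c := eq_of_nsmul_eq (K := K) 2 h22 (by
    rw [two_nsmul, two_nsmul, ← e2, k1])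
  have k3 : a * c = c * a := by
    calc a * c = a * (c * c * a) := by rw [k2]
      _ = a * (c * c) * a := by noncomm_ring
      _ = c * c * a * a := by rw [k1]
      _ = c * a := by rw [k2]
  have k4 : c * a = 1 := eq_of_nsmul_eq (K := K) 2 h22 (by
    rw [two_nsmul, two_nsmul, ← e1, k3])
  exact ⟨k4, k3.trans k4, ht⟩

/-- The left side is `(ad a)^4 z`. It comes from applying `T` to one Jordan identity and eliminating
everything but `z`, `a` and `c = a⁻¹`. -/
theorem ad_pow_four (hT : IsTwistedJordan T) (h2 : (2 : K) ≠ 0) {u : B} (hu : T u = 1) (y : B) :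
    let a := T 1
    let z := T (u * y + y * u)
    a * a * a * a * z - 4 • (a * a * a * z * a) + 6 • (a * a * z * a * a) - 4 • (a * z * a * a * a)
      + z * a * a * a * a = 0 := by
  intro a z
  obtain ⟨hca, hac, ht⟩ := hT.exists_inverse h2 hu
  have e0 := hT u y
  have e1 := hT u (u * y + y * u)
  have e2 := hT u (u * (u * y + y * u) + (u * y + y * u) * u)
  have f0 := hT (u * u) y
  have f1 := hT (u * u) (u * y + y * u)
  have g0 := hT (u * (u * u)) y
  have g1 := hT u (u * u * y + y * (u * u))
  -- In the commuting left and right multiplications `l`, `r` by `u`, this reads `2(l³+r³) +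
  -- (l+r)(l²+r²) + (l+r)³ = 4(l²+r²)(l+r)`.
  have key : 2 • (u * (u * u) * y + y * (u * (u * u)))
      + (u * (u * u * y + y * (u * u)) + (u * u * y + y * (u * u)) * u)
      + (u * (u * (u * y + y * u) + (u * y + y * u) * u)
        + (u * (u * y + y * u) + (u * y + y * u) * u) * u)
      = 4 • (u * u * (u * y + y * u) + (u * y + y * u) * (u * u)) := by noncomm_ring
  replace key := congrArg T key
  rw [map_add, map_add, map_nsmul, map_nsmul] at key
  rw [hu] at e0 e1 e2 g1
  rw [ht] at g0
  change T (u * u) * a = 1 at hca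
  change a * T (u * u) = 1 at hac
  change z * a + a * z = _ at e0
  change _ = 2 • (1 * z + z * 1) at e1
  change _ = 2 • (T (u * u) * z + z * T (u * u)) at f1
  change _ * a + a * _ = _ at e1 e2 f0 f1 g0 g1
  generalize T (u * (u * (u * y + y * u) + (u * y + y * u) * u)
        + (u * (u * y + y * u) + (u * y + y * u) * u) * u) = Y₃ at *
  generalize T (u * (u * y + y * u) + (u * y + y * u) * u) = Y₂ at *
  generalize T (u * (u * u * y + y * (u * u)) + (u * u * y + y * (u * u)) * u) = s at *
  generalize T (u * u * (u * y + y * u) + (u * y + y * u) * (u * u)) = q at *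
  generalize T (u * (u * u) * y + y * (u * (u * u))) = r at *
  generalize T (u * u * y + y * (u * u)) = p at *
  generalize T (u * u) = c at *
  generalize T y = Y at *
  clear_value z a
  -- Each anticommutator with `a` lowers the nesting by one: it is taken once here and once more in
  -- `k2`.
  have k1 : 4 • (c * c * Y + Y * (c * c)) + 4 • p + 4 • Y₂ = 8 • (c * z + z * c) := by
    have h := congrArg (fun x => x * a + a * x) key
    have h' : 2 • (r * a + a * r) + (s * a + a * s) + (Y₃ * a + a * Y₃)
        = 4 • (q * a + a * q) := by
      convert h using 1 <;> noncomm_ring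
    rw [g0, g1, e2, f1] at h'
    convert h' using 1 <;> first | noncomm_ring | abel
  have k2 : 4 • ((c * c * Y + Y * (c * c)) * a + a * (c * c * Y + Y * (c * c)))
      + 8 • (c * Y + Y * c) + 16 • z = 8 • ((c * z + z * c) * a + a * (c * z + z * c)) := by
    have h := congrArg (fun x => x * a + a * x) k1
    have h' : 4 • ((c * c * Y + Y * (c * c)) * a + a * (c * c * Y + Y * (c * c)))
        + 4 • (p * a + a * p) + 4 • (Y₂ * a + a * Y₂)
        = 8 • ((c * z + z * c) * a + a * (c * z + z * c)) := by
      convert h using 1 <;> noncomm_ring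
    rw [f0, e1] at h'
    rw [← h']
    noncomm_ring
  have e0' : 4 • Y = z * a + a * z := by rw [e0]; noncomm_ring
  have k3 : (c * c * (z * a + a * z) + (z * a + a * z) * (c * c)) * a
      + a * (c * c * (z * a + a * z) + (z * a + a * z) * (c * c))
      + 2 • (c * (z * a + a * z) + (z * a + a * z) * c) + 16 • z
      = 8 • ((c * z + z * c) * a + a * (c * z + z * c)) := by
    rw [← k2, ← e0']; noncomm_ring
  have hca' (x : B) : c * (a * x) = x := by rw [← mul_assoc, hca, one_mul]
  have hac' (x : B) : a * (c * x) = x := by rw [← mul_assoc, hac, one_mul]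
  -- Multiplying by `a²` on both sides clears every `c = a⁻¹`.
  have k4 := congrArg (fun x => a * (a * (x * (a * a)))) k3
  simp only [mul_add, add_mul, mul_smul_comm, smul_mul_assoc, mul_assoc, hca, hac, hca', hac',
    mul_one] at k4
  simp only [mul_assoc]
  rw [← sub_eq_zero] at k4
  rw [← k4]
  abel

theorem surjective_anticomm [FiniteDimensional K B] (hT : IsTwistedJordan T) (h2 : (2 : K) ≠ 0)
    (hinj : Function.Injective T) {u : B} (hu : T u = 1) :
    Function.Surjective fun y => T (u * y + y * u) := by
  let f : B →ₗ[K] B := T.comp (LinearMap.mulLeft K u + LinearMap.mulRight K u)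
  have hf : Function.Injective f := by
    rw [← LinearMap.ker_eq_bot, LinearMap.ker_eq_bot']
    intro y hy
    have h := hT u y
    have hy' : T (u * y + y * u) = 0 := hy
    rw [hu, hy', zero_mul, mul_zero, add_zero, one_mul, mul_one, ← two_nsmul, smul_smul] at h
    have h4 : ((2 * 2 : ℕ) : K) ≠ 0 := by rw [Nat.cast_mul]; exact mul_ne_zero h2 h2
    have : T y = 0 := eq_of_nsmul_eq (K := K) (2 * 2) h4 (by rw [← h, smul_zero])
    exact hinj (this.trans (map_zero T).symm)
  exact LinearMap.injective_iff_surjective.1 hf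

theorem injective_anticomm [FiniteDimensional K B] (hT : IsTwistedJordan T) (h2 : (2 : K) ≠ 0)
    (hsurj : Function.Surjective T) {u : B} (hu : T u = 1) :
    Function.Injective fun x => x * T 1 + T 1 * x := by
  let f : B →ₗ[K] B := LinearMap.mulRight K (T 1) + LinearMap.mulLeft K (T 1)
  have hf : Function.Surjective f := by
    intro x
    obtain ⟨y, hy⟩ := hsurj ((4 : K)⁻¹ • x)
    refine ⟨T (u * y + y * u), ?_⟩
    have h := hT u y
    rw [hu, hy, one_mul, mul_one, ← two_nsmul, smul_smul, ← Nat.cast_smul_eq_nsmul K,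
      smul_smul] at h
    have h4 : (4 : K) ≠ 0 := by
      rw [show (4 : K) = 2 * 2 by norm_num]; exact mul_ne_zero h2 h2
    rw [show ((2 * 2 : ℕ) : K) = 4 by norm_num, mul_inv_cancel₀ h4, one_smul] at h
    exact h
  exact LinearMap.injective_iff_surjective.2 hf

theorem mul_left (hT : IsTwistedJordan T) {l : B} (hl : ∀ x, Commute l x) :
    IsTwistedJordan ((LinearMap.mulLeft K l).comp T) := by
  have hl' (x y : B) : l * x * (l * y) = l * l * (x * y) := by
    rw [mul_assoc, ← mul_assoc x, ← (hl x).eq, mul_assoc, mul_assoc]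
  intro y z
  have h := congrArg (fun x => l * l * x) (hT y z)
  simp only [LinearMap.comp_apply, LinearMap.mulLeft_apply, hl']
  rw [mul_smul_comm, mul_add, mul_add] at h
  exact h

/-- With `T x = X = N Y` one has `N X = 0`, so the equations for `T(x²)` and `T(x³)` can be solved
explicitly. The two splittings of `x⁴` then differ exactly by `X⁴ N`. -/
theorem pow_four_mul_eq_zero (hT : IsTwistedJordan T) (h2 : (2 : K) ≠ 0)
    (hsurj : Function.Surjective T) (hinj : Function.Injective fun x => x * T 1 + T 1 * x)
    {N : B} (hN : T 1 = 1 + N) (hNN : N * N = 0) (Y : B) :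
    N * Y * (N * Y) * (N * Y) * (N * Y) * N = 0 := by
  obtain ⟨x, hx⟩ := hsurj (N * Y)
  set X := N * Y with hX
  have hNX : N * X = 0 := by rw [hX, ← mul_assoc, hNN, zero_mul]
  have hNX' (Z : B) : N * (X * Z) = 0 := by rw [← mul_assoc, hNX, zero_mul]
  have hc : Commute x (x * x) := (Commute.refl x).mul_right (Commute.refl x)
  have e1 := hT.commute_mul h2 (Commute.refl x)
  have e2 := hT.commute_mul h2 hc
  have e3 := hT.commute_mul h2 ((Commute.refl x).mul_right hc)
  have e4 := hT.commute_mul h2 (hc.mul_left hc)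
  rw [show x * (x * (x * x)) = x * x * (x * x) by noncomm_ring, e4] at e3
  -- The solution is guessed and checked: anticommutation with `T 1` is injective.
  have hW : 2 • T (x * x) = 2 • (X * X) - X * X * N := by
    refine hinj ?_
    have h : T (x * x) * T 1 + T 1 * T (x * x) = 2 • (X * X) := by rw [e1, hx, two_nsmul]
    have h' : 2 • T (x * x) * T 1 + T 1 * 2 • T (x * x) = 4 • (X * X) := by
      rw [smul_mul_assoc, mul_smul_comm, ← smul_add, h, smul_smul]; norm_num
    refine h'.trans ?_
    rw [hN]
    simp only [mul_add, add_mul, sub_mul, mul_sub, mul_smul_comm, smul_mul_assoc, mul_assoc, hNX',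
      hNN, mul_one, one_mul, mul_zero]
    abel
  have ht : 4 • T (x * (x * x)) = 4 • (X * X * X) - 3 • (X * X * X * N) := by
    refine hinj ?_
    have h : 4 • T (x * (x * x)) * T 1 + T 1 * 4 • T (x * (x * x))
        = 2 • (X * 2 • T (x * x) + 2 • T (x * x) * X) := by
      rw [smul_mul_assoc, mul_smul_comm, ← smul_add, e2, hx]
      noncomm_ring
    refine h.trans ?_
    rw [hN, hW]
    simp only [mul_add, add_mul, sub_mul, mul_sub, mul_smul_comm, smul_mul_assoc, mul_assoc, hNX,
      hNX', hNN, mul_one, one_mul, mul_zero, smul_zero]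
    abel
  have h : 2 • (2 • T (x * x) * 2 • T (x * x))
      = X * 4 • T (x * (x * x)) + 4 • T (x * (x * x)) * X := by
    have h' := congrArg (4 • ·) e3
    rw [hx] at h'
    convert h' using 1 <;> noncomm_ring
  rw [hW, ht, ← sub_eq_zero] at h
  simp only [sub_mul, mul_sub, mul_smul_comm, smul_mul_assoc, mul_assoc, hNX,
    hNX', mul_zero, smul_zero] at h
  rw [← neg_eq_zero, ← h]
  simp only [mul_assoc]
  abel

theorem map_mul_self (hT : IsTwistedJordan T) (h2 : (2 : K) ≠ 0) (h1 : T 1 = 1) (x : B) :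
    T (x * x) = T x * T x := by
  have := hT.commute_mul h2 (Commute.refl x)
  rw [h1, mul_one, one_mul, ← two_nsmul, ← two_nsmul] at this
  exact eq_of_nsmul_eq (K := K) 2 (by exact_mod_cast h2) this

theorem map_mul_mul (hT : IsTwistedJordan T) (h2 : (2 : K) ≠ 0) (h1 : T 1 = 1) (x y : B) :
    T (x * y * x) = T x * T y * T x := by
  have hmul (x y : B) : T (x * y + y * x) = T x * T y + T y * T x := by
    have := hT x y
    rw [h1, mul_one, one_mul, ← two_nsmul] at this
    exact eq_of_nsmul_eq (K := K) 2 (by exact_mod_cast h2) this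
  have e1 := hmul x (x * y + y * x)
  have e2 := hmul (x * x) y
  rw [hmul x y] at e1
  rw [hT.map_mul_self h2 h1] at e2
  have e4 : x * (x * y + y * x) + (x * y + y * x) * x
      = (x * x * y + y * (x * x)) + 2 • (x * y * x) := by noncomm_ring
  rw [e4, map_add, e2, map_nsmul] at e1
  refine eq_of_nsmul_eq (K := K) 2 (by exact_mod_cast h2) ?_
  rw [← sub_eq_iff_eq_add'.2 e1.symm]
  noncomm_ring

end IsTwistedJordan
end TwistedJordan
-- Matrices over a field: primeness, nilpotency, minimal idempotents
section MatrixLemmas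

variable {K n : Type*} [Field K] [Fintype n] [DecidableEq n]

theorem mul_single_mul_apply (A B : Matrix n n K) (i j k l : n) :
    (A * Matrix.single j k 1 * B : Matrix n n K) i l = A i j * B k l := by
  rw [Matrix.mul_assoc, Matrix.mul_apply, Finset.sum_eq_single j]
  · simp
  · intro b _ hb
    simp [Matrix.single_mul_apply_of_ne _ _ _ _ _ hb]
  · simp

theorem matrix_eq_zero_or_eq_zero {A B : Matrix n n K} (h : ∀ Y, A * Y * B = 0) :
    A = 0 ∨ B = 0 := by
  by_contra! hAB
  obtain ⟨i, j, hA⟩ : ∃ i j, A i j ≠ 0 := by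
    by_contra! h'; exact hAB.1 (Matrix.ext h')
  obtain ⟨k, l, hB⟩ : ∃ i j, B i j ≠ 0 := by
    by_contra! h'; exact hAB.2 (Matrix.ext h')
  have := congrFun (congrFun (h (Matrix.single j k 1)) i) l
  rw [mul_single_mul_apply] at this
  exact mul_ne_zero hA hB this

theorem exists_sub_scalar_mul_self_eq_zero [IsAlgClosed K] [Nonempty n] (h2 : (2 : K) ≠ 0)
    (h3 : (3 : K) ≠ 0) {a : Matrix n n K}
    (h : ∀ z, a * a * a * a * z - 4 • (a * a * a * z * a) + 6 • (a * a * z * a * a)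
      - 4 • (a * z * a * a * a) + z * a * a * a * a = 0) :
    ∃ c : K, (a - algebraMap K _ c) * (a - algebraMap K _ c) = 0 := by
  obtain ⟨c, hc⟩ := Module.End.exists_eigenvalue (Matrix.toLin' a)
  obtain ⟨v, hv⟩ := hc.exists_hasEigenvector
  have hv1 : a.mulVec v = c • v := by simpa using hv.apply_eq_smul
  have hv0 : v ≠ 0 := hv.2
  refine ⟨c, ?_⟩
  set N := a - algebraMap K (Matrix n n K) c with hN
  have hNv : N.mulVec v = 0 := by
    rw [hN, Matrix.sub_mulVec, hv1, Algebra.algebraMap_eq_smul_one, Matrix.smul_mulVec,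
      Matrix.one_mulVec, sub_self]
  have ha : a = N + algebraMap K (Matrix n n K) c := by rw [hN, sub_add_cancel]
  -- `ad` does not see the scalar `c`, so `(ad N)^4 = 0`.
  have hN4 (z : Matrix n n K) : N * N * N * N * z - 4 • (N * N * N * z * N)
      + 6 • (N * N * z * N * N) - 4 • (N * z * N * N * N) + z * N * N * N * N = 0 := by
    rw [← h z, ha]
    have hs (x : Matrix n n K) : x * algebraMap K _ c = algebraMap K _ c * x :=
      (Algebra.commutes c x).symm
    have hs' (x y : Matrix n n K) :
        x * (algebraMap K _ c * y) = algebraMap K _ c * (x * y) := by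
      rw [← mul_assoc, hs, mul_assoc]
    generalize algebraMap K (Matrix n n K) c = s at *
    clear_value N
    simp only [mul_assoc, mul_add, add_mul, hs, hs']
    abel
  have h4 : N * N * N * N = 0 := by
    -- `V` is a nonzero matrix with all columns in the kernel of `N`: right multiplication by it
    -- leaves only `N⁴ z V`.
    let V := Matrix.vecMulVec v (1 : n → K)
    have hNV : N * V = 0 := by rw [Matrix.mul_vecMulVec, hNv, Matrix.zero_vecMulVec]
    refine (matrix_eq_zero_or_eq_zero (B := V) fun z => ?_).resolve_right fun hV => hv0 ?_
    · have := congrArg (· * V) (hN4 z)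
      simpa only [add_mul, sub_mul, smul_mul_assoc, mul_assoc, hNV, mul_zero, smul_zero, sub_zero,
        add_zero, zero_mul] using this
    · funext i
      simpa [V, Matrix.vecMulVec_apply] using congrFun (congrFun hV i) (Classical.arbitrary n)
  have hcancel (m : ℕ) (hm : (m : K) ≠ 0) (x : Matrix n n K) (hx : m • x = 0) : x = 0 :=
    eq_of_nsmul_eq (K := K) m hm (by rw [hx, smul_zero])
  have h4' (x : Matrix n n K) : N * (N * (N * (N * x))) = 0 := by
    simp only [← mul_assoc]; rw [h4, zero_mul]
  -- Left multiplication by `N²` leaves only `4 N³ z N³`; afterwards `N³ = 0` leaves only `6 N² z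
  -- N²`. Primeness finishes both.
  have h3' : N * N * N = 0 := by
    refine or_self_iff.1 (matrix_eq_zero_or_eq_zero fun z => hcancel 4 ?_ _ ?_)
    · rw [show ((4 : ℕ) : K) = 2 * 2 by norm_num]; exact mul_ne_zero h2 h2
    · have := congrArg (N * N * ·) (hN4 z)
      simp only [mul_assoc] at h4
      simpa only [mul_add, mul_sub, mul_smul_comm, mul_assoc, h4', h4, mul_zero, zero_mul,
        mul_neg, neg_zero, smul_zero, sub_zero, zero_sub, add_zero, zero_add, neg_eq_zero] using this
  have h3'' (x : Matrix n n K) : N * (N * (N * x)) = 0 := by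
    simp only [← mul_assoc]; rw [h3', zero_mul]
  refine or_self_iff.1 (matrix_eq_zero_or_eq_zero fun z => hcancel 6 ?_ _ ?_)
  · rw [show ((6 : ℕ) : K) = 2 * 3 by norm_num]; exact mul_ne_zero h2 h3
  · have := hN4 z
    simp only [mul_assoc] at h3'
    simpa only [mul_assoc, h3'', h3', mul_zero, zero_mul, smul_zero, sub_zero, zero_sub, add_zero,
      zero_add, neg_eq_zero] using this

theorem exists_mul_ne_zero {N : Matrix n n K} (hN : N ≠ 0) :
    ∃ Y, N * Y * (N * Y) * (N * Y) * (N * Y) * N ≠ 0 := by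
  obtain ⟨i, j, hA⟩ : ∃ i j, N i j ≠ 0 := by
    by_contra! h'; exact hN (Matrix.ext h')
  -- For this matrix unit the `(i, j)` entry of the product is `(N i j)^5`.
  refine ⟨Matrix.single j i 1, fun h => ?_⟩
  have key (M : Matrix n n K) : (N * Matrix.single j i 1 * M : Matrix n n K) i j = N i j * M i j :=
    mul_single_mul_apply ..
  have := congrFun (congrFun h i) j
  simp only [mul_assoc] at this
  simp only [← mul_assoc N (Matrix.single j i 1), key] at this
  simp [hA] at this

/-- Sandwiching a matrix unit gives `c = q i j` from an entry and `q i j = c * tr q` from the trace;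
this works in every characteristic. -/
theorem trace_eq_one_of_minimal {q : Matrix n n K} (h0 : q ≠ 0) (hq : q * q = q)
    (h : ∀ Y, ∃ c : K, q * Y * q = c • q) : q.trace = 1 := by
  obtain ⟨i, j, hA⟩ : ∃ i j, q i j ≠ 0 := by
    by_contra! h'; exact h0 (Matrix.ext h')
  obtain ⟨c, hc⟩ := h (Matrix.single j i 1)
  have h1 := congrFun (congrFun hc i) j
  rw [mul_single_mul_apply, Matrix.smul_apply, smul_eq_mul] at h1
  have hcq : q i j = c := mul_right_cancel₀ hA h1
  have h2 := congrArg Matrix.trace hc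
  rw [Matrix.trace_mul_comm, ← mul_assoc, hq, Matrix.trace_smul, smul_eq_mul,
    Matrix.trace_mul_single] at h2
  simp only [MulOpposite.op_one, one_smul] at h2
  rw [hcq] at h2 hA
  exact (mul_left_cancel₀ hA (by rw [← h2, mul_one]))

end MatrixLemmas

/-! ### Products of matrix algebras -/

section Product

variable {K ι : Type*} [Field K] [DecidableEq ι] {d : ι → ℕ}

theorem pi_eq_of_trace_mul {x y : (i : ι) → Matrix (Fin (d i)) (Fin (d i)) K}
    (h : ∀ z i, ((z * x) i).trace = ((z * y) i).trace) : x = y := by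
  funext i
  refine Matrix.ext_iff_trace_mul_left.2 fun z => ?_
  simpa using h (Pi.single i z) i

/-- Both sides are paired with an arbitrary `T x` under the trace; the left one is evaluated by the
hypothesis with `1` as an argument. -/
theorem isTwistedJordan_of_trace
    {T : ((i : ι) → Matrix (Fin (d i)) (Fin (d i)) K) →ₗ[K]
      ((i : ι) → Matrix (Fin (d i)) (Fin (d i)) K)}
    (hT : Function.Surjective T)
    (h : ∀ x y z i, ((T x * (T y * T z + T z * T y)) i).trace
      = ((x * (y * z + z * y)) i).trace) : IsTwistedJordan T := by
  intro y z
  refine pi_eq_of_trace_mul fun w i => ?_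
  obtain ⟨x, rfl⟩ := hT w
  rw [h, two_nsmul, mul_add (T x) (_ + _) (_ + _), Pi.add_apply, Matrix.trace_add, h]
  simp [mul_add]

theorem map_pow_four_of_trace [Fintype ι] [IsAlgClosed K] [∀ i, NeZero (d i)] (h2 : (2 : K) ≠ 0)
    (h3 : (3 : K) ≠ 0)
    {T : ((i : ι) → Matrix (Fin (d i)) (Fin (d i)) K) →ₗ[K]
      ((i : ι) → Matrix (Fin (d i)) (Fin (d i)) K)}
    (hT : Function.Bijective T)
    (h : ∀ x y z i, ((T x * (T y * T z + T z * T y)) i).trace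
      = ((x * (y * z + z * y)) i).trace) (x : (i : ι) → Matrix (Fin (d i)) (Fin (d i)) K) :
    T (x * x * x * x) = T x * T x * T x * T x := by
  have hJ := isTwistedJordan_of_trace hT.2 h
  obtain ⟨u, hu⟩ := hT.2 1
  obtain ⟨-, hac, -⟩ := hJ.exists_inverse h2 hu
  have hblock (i : ι) : ∃ c : K,
      (T 1 i - algebraMap K _ c) * (T 1 i - algebraMap K _ c) = 0 := by
    refine exists_sub_scalar_mul_self_eq_zero h2 h3 fun z => ?_
    obtain ⟨y, hy⟩ := hJ.surjective_anticomm h2 hT.1 hu (Pi.single i z)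
    have := congrFun (hJ.ad_pow_four h2 hu y) i
    have hy' : T (u * y + y * u) = Pi.single i z := hy
    rw [hy'] at this
    simpa using this
  choose c hc using hblock
  have hc0 (i : ι) : c i ≠ 0 := by
    intro h0
    have h1 := hc i
    have h2 := congrFun hac i
    rw [h0, map_zero, sub_zero] at h1
    have h3 : T 1 i * (T 1 i * T (u * u) i) = T 1 i := by
      rw [← Pi.mul_apply, hac, Pi.one_apply, mul_one]
    rw [← mul_assoc, h1, zero_mul] at h3
    rw [Pi.mul_apply, ← h3, zero_mul] at h2
    exact zero_ne_one h2
  let l : (i : ι) → Matrix (Fin (d i)) (Fin (d i)) K := fun i => algebraMap K _ (c i)⁻¹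
  have hl (y) : Commute l y := by
    funext i
    exact Algebra.commutes _ _
  let J := (LinearMap.mulLeft K l).comp T
  have hJ' : IsTwistedJordan J := hJ.mul_left hl
  have hJs : Function.Surjective J := by
    intro y
    obtain ⟨z, hz⟩ := hT.2 (fun i => c i • y i)
    refine ⟨z, ?_⟩
    funext i
    simp [J, l, hz, Algebra.algebraMap_eq_smul_one, hc0 i]
  have hTJ (y) (i) : T y i = c i • J y i := by
    simp [J, l, Algebra.algebraMap_eq_smul_one, hc0 i]
  -- Otherwise `N = J 1 - 1` is nonzero in some block, against the identity for `N Y`.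
  have hJ1 : J 1 = 1 := by
    obtain ⟨v, hv⟩ := hJs 1
    by_contra hne
    obtain ⟨i, hi⟩ := Function.ne_iff.1 (sub_ne_zero.2 hne)
    obtain ⟨Y, hY⟩ := exists_mul_ne_zero hi
    have hNN : (J 1 - 1) * (J 1 - 1) = 0 := by
      funext i
      have h1 := congrArg (fun x => (c i)⁻¹ • (c i)⁻¹ • x) (hc i)
      rw [hTJ 1 i, Algebra.algebraMap_eq_smul_one, ← smul_sub] at h1
      simpa [hc0 i, smul_smul] using h1
    have := hJ'.pow_four_mul_eq_zero h2 hJs (hJ'.injective_anticomm h2 hJs hv)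
      (add_sub_cancel 1 (J 1)).symm hNN (Pi.single i Y)
    refine hY ?_
    simpa using congrFun this i
  have htr (y) (i) : c i ^ 3 * (J y i).trace = (y i).trace := by
    have h1 := h y 1 1 i
    have h2' : (2 : K) * (c i ^ 3 * (J y i).trace) = 2 * (y i).trace := by
      simp only [Pi.mul_apply, Pi.add_apply, hTJ, hJ1, Pi.one_apply] at h1
      simp [mul_add, Matrix.trace_add, Matrix.trace_smul] at h1
      linear_combination h1
    exact mul_left_cancel₀ h2 h2'
  have hc3 (i : ι) : c i ^ 3 = 1 := by
    -- A minimal idempotent of trace 1 in block `i`. Its image under `J` is again minimal, so has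
    -- trace 1 in that block, and `htr` gives `c i ^ 3 = 1`.
    let e : (i : ι) → Matrix (Fin (d i)) (Fin (d i)) K := Pi.single i (Matrix.single 0 0 1)
    have he (y) : e * y * e = y i 0 0 • e := by
      funext k
      by_cases hk : k = i
      · subst hk
        ext r s
        simp [e, Matrix.single_mul_mul_single, Matrix.single_apply]
      · simp [e, hk]
    have hmin (Y) : J e * Y * J e = ((Function.surjInv hJs Y) i 0 0) • J e := by
      conv_lhs => rw [← Function.surjInv_eq hJs Y]
      rw [← hJ'.map_mul_mul h2 hJ1, he, map_smul]
    have hte : (e i).trace = 1 := by simp [e]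
    have hne : J e i ≠ 0 := by
      intro h0
      have := htr e i
      rw [h0, hte] at this
      simp at this
    have hq : J e * J e = J e := by
      have := hJ'.map_mul_mul h2 hJ1 e 1
      rw [he, hJ1, map_smul] at this
      simpa using this.symm
    have := trace_eq_one_of_minimal hne (congrFun hq i) (fun Y => ⟨_, by
      simpa using congrFun (hmin (Pi.single i Y)) i⟩)
    have h1 := htr e i
    rwa [this, hte, mul_one] at h1
  have hsq (y) : J (y * y) = J y * J y := hJ'.map_mul_self h2 hJ1 y
  funext i
  rw [mul_assoc (x * x), Pi.mul_apply, Pi.mul_apply, Pi.mul_apply, hTJ, hTJ, hsq, hsq]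
  simp only [Pi.mul_apply, smul_mul_assoc, mul_smul_comm, smul_smul, mul_assoc]
  congr 1
  linear_combination (-c i) * hc3 i

theorem map_sq_of_trace (h2 : (2 : K) ≠ 0)
    {T : ((i : ι) → Matrix (Fin (d i)) (Fin (d i)) K) →ₗ[K]
      ((i : ι) → Matrix (Fin (d i)) (Fin (d i)) K)}
    (hT : Function.Surjective T)
    (h : ∀ x y z i, ((T x * (T y * T z + T z * T y)) i).trace
      = ((x * (y * z + z * y)) i).trace) (h1 : T 1 = 1)
    (x : (i : ι) → Matrix (Fin (d i)) (Fin (d i)) K) :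
    T (x * x) = T x * T x :=
  (isTwistedJordan_of_trace hT h).map_mul_self h2 h1 x

end Product

/-! ### Wedderburn structure modulo the radical, without a unit -/

section Structure

variable {K A : Type*} [Field K] [NonUnitalRing A] [Module K A] [IsScalarTower K A A]
  [SMulCommClass K A A]

theorem inr_mem_pow_of_mem_powSucc {I : Submodule K A} {J : Ideal (Unitization K A)}
    (h : ∀ x ∈ I, (x : Unitization K A) ∈ J) (n : ℕ) :
    ∀ x ∈ powSucc I n, (x : Unitization K A) ∈ J ^ (n + 1) := by
  induction n with
  | zero => simpa [powSucc, Submodule.pow_one] using h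
  | succ n ih =>
    let J' : Submodule K A :=
      ((J ^ (n + 1 + 1)).restrictScalars K).comap (Unitization.inrHom K K A)
    have hle : idealMul (powSucc I n) I ≤ J' := by
      refine idealMul_le.2 fun x hx y hy => ?_
      change ((x * y : A) : Unitization K A) ∈ J ^ (n + 1 + 1)
      rw [Unitization.inr_mul, Submodule.pow_succ]
      exact Ideal.mul_mem_mul (ih x hx) (h y hy)
    exact fun x hx => hle hx

/-- Wedderburn is applied to the unitization modulo its Jacobson radical. The image of `A` there is
an ideal, hence a product of some of the blocks. -/
theorem exists_pi_matrix_hom [IsAlgClosed K] [FiniteDimensional K A] :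
    ∃ (ι : Type) (_ : Fintype ι) (_ : DecidableEq ι) (d : ι → ℕ) (_ : ∀ i, NeZero (d i))
      (π : A →ₗ[K] (i : ι) → Matrix (Fin (d i)) (Fin (d i)) K),
      (∀ x y, π (x * y) = π x * π y) ∧ Function.Surjective π ∧ LinearMap.ker π ≤ rad K A := by
  classical
  have : Module.Finite K (Unitization K A) :=
    Module.Finite.equiv (Unitization.linearEquiv K K A).symm
  have : IsArtinianRing (Unitization K A) := IsArtinianRing.of_finite K _
  let J := Ring.jacobson (Unitization K A)
  obtain ⟨m, d, hd, ⟨e⟩⟩ :=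
    IsSemisimpleRing.exists_algEquiv_pi_matrix_of_isAlgClosed K (Unitization K A ⧸ J)
  let q : Unitization K A →ₐ[K] (i : Fin m) → Matrix (Fin (d i)) (Fin (d i)) K :=
    e.toAlgHom.comp (Ideal.Quotient.mkₐ K J)
  have hq : Function.Surjective q := e.surjective.comp (Ideal.Quotient.mkₐ_surjective K J)
  have hqker (x : Unitization K A) (hx : q x = 0) : x ∈ J := by
    have : e (Ideal.Quotient.mk J x) = 0 := hx
    exact Ideal.Quotient.eq_zero_iff_mem.1 ((map_eq_zero_iff e e.injective).1 this)
  -- Only the blocks on which `A` acts nontrivially are kept.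
  let ι := {i : Fin m // ∃ x : A, q x i ≠ 0}
  let π : A →ₗ[K] (i : ι) → Matrix (Fin (d i)) (Fin (d i)) K :=
    LinearMap.pi fun i => (LinearMap.proj i.1).comp (q.toLinearMap.comp (Unitization.inrHom K K A))
  have hπ (x : A) (i : ι) : π x i = q x i.1 := rfl
  have hπmul (x y : A) : π (x * y) = π x * π y := by
    funext i
    simp only [hπ, Pi.mul_apply, Unitization.inr_mul, map_mul]
  refine ⟨ι, inferInstance, inferInstance, fun i => d i.1, fun i => hd i.1, π, hπmul, ?_, ?_⟩
  · -- the range of `π` contains every matrix unit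
    let S := LinearMap.range (q.toLinearMap.comp (Unitization.inrHom K K A))
    have hS (b) (x : A) (c) : b * q x * c ∈ S := by
      obtain ⟨b, rfl⟩ := hq b
      obtain ⟨c, rfl⟩ := hq c
      have hz : (b * (x : Unitization K A) * c).fst = 0 := by simp
      refine ⟨(b * (x : Unitization K A) * c).snd, ?_⟩
      have hz' : (((b * (x : Unitization K A) * c).snd : A) : Unitization K A)
          = b * (x : Unitization K A) * c := by
        ext
        · rw [hz, Unitization.fst_inr]
        · rw [Unitization.snd_inr]
      change q _ = _
      rw [Unitization.inrHom_apply, hz', map_mul, map_mul]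
    have hunit (i : ι) (r s) : Pi.single i.1 (Matrix.single r s 1) ∈ S := by
      obtain ⟨x, hx⟩ := i.2
      obtain ⟨k, l, hkl⟩ : ∃ k l, q x i.1 k l ≠ 0 := by
        by_contra! h'; exact hx (Matrix.ext h')
      have h1 := S.smul_mem (q x i.1 k l)⁻¹ (hS (Pi.single i.1 (Matrix.single r k 1)) x
        (Pi.single i.1 (Matrix.single l s 1)))
      convert h1 using 1
      funext j
      by_cases hj : j = i.1
      · subst hj
        simp [Matrix.single_mul_mul_single, hkl]
      · simp [hj]
    have hsingle (i : ι) (M) : Pi.single i.1 M ∈ S := by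
      let f := LinearMap.single K (fun i => Matrix (Fin (d i)) (Fin (d i)) K) i.1
      have : M ∈ S.comap f := by
        rw [Matrix.matrix_eq_sum_single M]
        refine Submodule.sum_mem _ fun r _ => Submodule.sum_mem _ fun s _ => ?_
        have := (S.comap f).smul_mem (M r s) (hunit i r s)
        simpa using this
      exact this
    intro y
    let y' : (i : Fin m) → Matrix (Fin (d i)) (Fin (d i)) K :=
      ∑ i : ι, Pi.single i.1 (y i)
    have hy' : y' ∈ S := Submodule.sum_mem _ fun i _ => hsingle i (y i)
    obtain ⟨x, hx⟩ := hy'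
    refine ⟨x, ?_⟩
    funext i
    have : q x i.1 = y' i.1 := congrFun hx i.1
    rw [hπ, this]
    change (∑ i : ι, Pi.single i.1 (y i) : (i : Fin m) → Matrix (Fin (d i)) (Fin (d i)) K) i.1 = _
    rw [Finset.sum_apply, Finset.sum_eq_single i]
    · simp
    · intro j _ hj
      exact Pi.single_eq_of_ne (fun h => hj (Subtype.ext h.symm)) _
    · simp
  · refine le_sSup ⟨?_, ?_⟩
    · intro a x hx
      rw [LinearMap.mem_ker] at hx
      simp only [LinearMap.mem_ker, hπmul, hx, mul_zero, zero_mul, and_self]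
    · obtain ⟨n, hn⟩ := IsSemiprimaryRing.isNilpotent (R := Unitization K A)
      refine ⟨n, (Submodule.eq_bot_iff _).2 fun x hx => ?_⟩
      have hker (x : A) (hx : x ∈ LinearMap.ker π) : (x : Unitization K A) ∈ J := by
        refine hqker _ (funext fun i => ?_)
        by_contra hne
        exact hne (congrFun (LinearMap.mem_ker.1 hx) ⟨i, x, hne⟩)
      have h1 := inr_mem_pow_of_mem_powSucc hker n x hx
      have h2 : J ^ (n + 1) = 0 := by rw [Submodule.pow_succ, hn]; exact zero_mul _
      rw [h2] at h1
      exact Unitization.inr_injective (h1 : (x : Unitization K A) = 0)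

end Structure

/-! ### The algebraically closed case -/

section AlgClosed

variable {K A : Type*} [Field K] [NonUnitalRing A] [Module K A]

theorem trace_eq_zero_of_mem_commutatorSpace {n : Type*} [Fintype n] {ρ : A →ₗ[K] Matrix n n K}
    (hρ : ∀ x y, ρ (x * y) = ρ x * ρ y) {x : A} (hx : x ∈ commutatorSpace K A) :
    (ρ x).trace = 0 := by
  have : commutatorSpace K A ≤ LinearMap.ker ((Matrix.traceLinearMap n K K).comp ρ) := by
    refine Submodule.span_le.2 ?_
    rintro _ ⟨x, y, rfl⟩
    simp [hρ, Matrix.trace_mul_comm (ρ x)]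
  exact this hx

theorem exists_descent [FiniteDimensional K A] {ι : Type*} [Fintype ι] [DecidableEq ι]
    {d : ι → ℕ} {π Φ : A →ₗ[K] (i : ι) → Matrix (Fin (d i)) (Fin (d i)) K}
    (h2 : (2 : K) ≠ 0) (hπ : Function.Surjective π)
    (h : ∀ x y z i, ((Φ x * (Φ y * Φ z + Φ z * Φ y)) i).trace
      = ((π x * (π y * π z + π z * π y)) i).trace) :
    ∃ T : ((i : ι) → Matrix (Fin (d i)) (Fin (d i)) K) →ₗ[K]
      ((i : ι) → Matrix (Fin (d i)) (Fin (d i)) K),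
      Function.Bijective T ∧ ∀ x, T (π x) = Φ x := by
  have hle : LinearMap.ker Φ ≤ LinearMap.ker π := by
    intro x hx
    rw [LinearMap.mem_ker] at hx ⊢
    have h22 : ((2 : ℕ) : K) ≠ 0 := by exact_mod_cast h2
    refine eq_of_nsmul_eq (K := K) 2 h22 (pi_eq_of_trace_mul fun w i => ?_)
    obtain ⟨y, rfl⟩ := hπ w
    obtain ⟨z, hz⟩ := hπ 1
    have := h x y z i
    rw [hx, zero_mul, hz, mul_one, one_mul, ← two_nsmul] at this
    rw [smul_zero, mul_zero, this, mul_smul_comm, mul_smul_comm, Pi.smul_apply, Pi.smul_apply,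
      Matrix.trace_smul, Matrix.trace_smul, Pi.mul_apply, Matrix.trace_mul_comm, Pi.mul_apply]
  -- The rank of `Φ` is at most that of the surjective `π`, so the inclusion of kernels is an
  -- equality.
  have hker : LinearMap.ker Φ = LinearMap.ker π := by
    refine Submodule.eq_of_le_of_finrank_le hle ?_
    have e1 := LinearMap.finrank_range_add_finrank_ker Φ
    have e2 := LinearMap.finrank_range_add_finrank_ker π
    rw [LinearMap.range_eq_top.2 hπ, finrank_top] at e2
    have := Submodule.finrank_le (LinearMap.range Φ)
    omega
  obtain ⟨s, hs⟩ := π.exists_rightInverse_of_surjective (LinearMap.range_eq_top.2 hπ)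
  have hs' (y) : π (s y) = y := LinearMap.congr_fun hs y
  have hT (x) : Φ (s (π x)) = Φ x := by
    rw [← sub_eq_zero, ← map_sub, ← LinearMap.mem_ker, hker, LinearMap.mem_ker, map_sub, hs',
      sub_self]
  have hinj : Function.Injective (Φ.comp s) := by
    rw [← LinearMap.ker_eq_bot, LinearMap.ker_eq_bot']
    intro y hy
    have : s y ∈ LinearMap.ker π := hker ▸ LinearMap.mem_ker.2 hy
    rw [← hs' y, LinearMap.mem_ker.1 this]
  exact ⟨Φ.comp s, ⟨hinj, LinearMap.injective_iff_surjective.1 hinj⟩, hT⟩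

theorem map_pow_four_and_map_sq_of_isAlgClosed [IsAlgClosed K] [IsScalarTower K A A]
    [SMulCommClass K A A] [FiniteDimensional K A] (h2 : (2 : K) ≠ 0) (h3 : (3 : K) ≠ 0)
    (T : A →ₗ[K] A)
    (hT : ∀ x y z : A, T x * (T y * T z + T z * T y) - x * (y * z + z * y)
      ∈ commutatorSpace K A) :
    (∀ x : A, T (x * x * x * x) - T x * T x * T x * T x ∈ rad K A) ∧
    (∀ e : A, (∀ x : A, e * x = x ∧ x * e = x) → T e = e →
      ∀ x : A, T (x * x) - T x * T x ∈ rad K A) := by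
  obtain ⟨ι, _, _, d, _, π, hmul, hsurj, hker⟩ := exists_pi_matrix_hom (K := K) (A := A)
  have htr (x y z i) : ((π (T x) * (π (T y) * π (T z) + π (T z) * π (T y))) i).trace
      = ((π x * (π y * π z + π z * π y)) i).trace := by
    have := trace_eq_zero_of_mem_commutatorSpace (ρ := (LinearMap.proj i).comp π)
      (fun x y => by simp [hmul]) (hT x y z)
    rw [map_sub, Matrix.trace_sub, sub_eq_zero] at this
    simpa [hmul] using this
  obtain ⟨S, hS, hSπ⟩ := exists_descent (Φ := π.comp T) h2 hsurj htr
  have hS' (x) : S (π x) = π (T x) := hSπ x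
  have htrS (x y z i) : ((S x * (S y * S z + S z * S y)) i).trace
      = ((x * (y * z + z * y)) i).trace := by
    obtain ⟨x, rfl⟩ := hsurj x
    obtain ⟨y, rfl⟩ := hsurj y
    obtain ⟨z, rfl⟩ := hsurj z
    simp only [hS', htr]
  refine ⟨fun x => hker ?_, fun e he hTe x => hker ?_⟩
  · rw [LinearMap.mem_ker, map_sub, sub_eq_zero, ← hS']
    simp only [hmul]
    rw [map_pow_four_of_trace h2 h3 hS htrS]
    simp only [hS']
  · rw [LinearMap.mem_ker, map_sub, sub_eq_zero, ← hS', hmul, hmul, ← hS']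
    refine map_sq_of_trace h2 hS.2 htrS ?_ _
    obtain ⟨v, hv⟩ := hsurj 1
    have he1 : π e = 1 := by
      rw [← mul_one (π e), ← hv, ← hmul, (he v).1]
    rw [← he1, hS', hTe]

end AlgClosed

open scoped TensorProduct

/-! ### Polarization and extension of scalars -/

section BaseChange

variable {F A : Type*} [Field F] [NonUnitalRing A] [Module F A]

theorem commutator_mem (x y : A) : x * y - y * x ∈ commutatorSpace F A :=
  Submodule.subset_span ⟨x, y, rfl⟩

theorem polarized_mem_commutatorSpace (h3 : (3 : F) ≠ 0) (T : A →ₗ[F] A)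
    (hT : ∀ x : A, T x * T x * T x - x * x * x ∈ commutatorSpace F A) (x y z : A) :
    T x * (T y * T z + T z * T y) - x * (y * z + z * y) ∈ commutatorSpace F A := by
  -- Modulo commutators, cyclic rotations of a product agree, so the six-term symmetric sum is three
  -- times the wanted form.
  have hc (x y z : A) : 3 • (x * (y * z + z * y)) - (x * y * z + y * z * x + z * x * y
      + x * z * y + z * y * x + y * x * z) ∈ commutatorSpace F A := by
    have h := add_mem (add_mem (commutator_mem (F := F) x (y * z)) (commutator_mem (x * y) z))
      (add_mem (commutator_mem (F := F) x (z * y)) (commutator_mem (x * z) y))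
    convert h using 1
    noncomm_ring
  have hs : T x * T y * T z + T y * T z * T x + T z * T x * T y
      + T x * T z * T y + T z * T y * T x + T y * T x * T z - (x * y * z + y * z * x + z * x * y
      + x * z * y + z * y * x + y * x * z) ∈ commutatorSpace F A := by
    have h := add_mem (sub_mem (sub_mem (sub_mem (hT (x + y + z)) (hT (x + y))) (hT (x + z)))
      (hT (y + z))) (add_mem (add_mem (hT x) (hT y)) (hT z))
    convert h using 1
    simp only [map_add]
    noncomm_ring
  have h := sub_mem (add_mem (hc (T x) (T y) (T z)) hs) (hc x y z)
  have h' : (3 : F) • (T x * (T y * T z + T z * T y) - x * (y * z + z * y))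
      ∈ commutatorSpace F A := by
    convert h using 1
    rw [show (3 : F) = ((3 : ℕ) : F) by norm_num, Nat.cast_smul_eq_nsmul, smul_sub]
    abel
  exact (Submodule.smul_mem_iff _ h3).1 h'

variable [IsScalarTower F A A] [SMulCommClass F A A] {K : Type*} [Field K] [Algebra F K]

theorem tmul_mem_commutatorSpace (k : K) {x : A} (hx : x ∈ commutatorSpace F A) :
    k ⊗ₜ[F] x ∈ commutatorSpace K (K ⊗[F] A) := by
  have hle : commutatorSpace F A ≤
      ((commutatorSpace K (K ⊗[F] A)).restrictScalars F).comap (TensorProduct.mk F K A k) := by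
    refine Submodule.span_le.2 ?_
    rintro _ ⟨x, y, rfl⟩
    have := commutator_mem (F := K) (k ⊗ₜ[F] x) ((1 : K) ⊗ₜ[F] y)
    simpa [TensorProduct.tmul_sub] using this
  exact hle hx

theorem baseChange_mem_commutatorSpace (T : A →ₗ[F] A)
    (hT : ∀ x y z : A, T x * (T y * T z + T z * T y) - x * (y * z + z * y)
      ∈ commutatorSpace F A) (x y z : K ⊗[F] A) :
    T.baseChange K x * (T.baseChange K y * T.baseChange K z
      + T.baseChange K z * T.baseChange K y) - x * (y * z + z * y)
      ∈ commutatorSpace K (K ⊗[F] A) := by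
  set S := T.baseChange K with hS
  induction x with
  | zero => simp
  | add x₁ x₂ h₁ h₂ =>
    convert add_mem h₁ h₂ using 1
    rw [map_add]
    noncomm_ring
  | tmul k x =>
  induction y with
  | zero => simp
  | add y₁ y₂ h₁ h₂ =>
    convert add_mem h₁ h₂ using 1
    rw [map_add]
    noncomm_ring
  | tmul l y =>
  induction z with
  | zero => simp
  | add z₁ z₂ h₁ h₂ =>
    convert add_mem h₁ h₂ using 1
    rw [map_add]
    noncomm_ring
  | tmul m z =>
  convert tmul_mem_commutatorSpace (k * (l * m)) (hT x y z) using 1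
  simp only [hS, LinearMap.baseChange_tmul, Algebra.TensorProduct.tmul_mul_tmul, mul_comm m l,
    ← TensorProduct.tmul_add, ← TensorProduct.tmul_sub]

/-- The preimage of the extended radical is a nilpotent ideal, because `A` embeds in `K ⊗ A`. -/
theorem mem_rad_of_one_tmul_mem_rad [FiniteDimensional F A] {x : A}
    (hx : (1 : K) ⊗ₜ[F] x ∈ rad K (K ⊗[F] A)) : x ∈ rad F A := by
  obtain ⟨hid, n, hn⟩ := (isGreatest_rad (F := K) (A := K ⊗[F] A)).1
  let I : Submodule F A := ((rad K (K ⊗[F] A)).restrictScalars F).comap (TensorProduct.mk F K A 1)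
  have hI : IsIdeal I := by
    intro a y hy
    have h := hid ((1 : K) ⊗ₜ[F] a) _ hy
    simpa [I] using h
  have hpow (m : ℕ) : ∀ y ∈ powSucc I m, (1 : K) ⊗ₜ[F] y ∈ powSucc (rad K (K ⊗[F] A)) m := by
    induction m with
    | zero => exact fun y hy => hy
    | succ m ih =>
      have hle : powSucc I (m + 1) ≤ ((powSucc (rad K (K ⊗[F] A)) (m + 1)).restrictScalars F).comap
          (TensorProduct.mk F K A 1) := by
        refine idealMul_le.2 fun y hy z hz => ?_
        have := mul_mem_idealMul (ih y hy) (show (1 : K) ⊗ₜ[F] z ∈ rad K (K ⊗[F] A) from hz)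
        rw [Algebra.TensorProduct.tmul_mul_tmul, mul_one] at this
        exact this
      exact fun y hy => hle hy
  suffices hI0 : powSucc I n = ⊥ by
    have hI' : IsNilpotentIdeal I := ⟨hI, n, hI0⟩
    exact isGreatest_rad.2 hI' hx
  refine (Submodule.eq_bot_iff _).2 fun y hy => ?_
  have := hpow n y hy
  rw [hn, Submodule.mem_bot] at this
  exact Module.FaithfullyFlat.tensorProduct_mk_injective (A := F) (B := K) A
    (this.trans (TensorProduct.tmul_zero _ _).symm)

end BaseChange

end FinDimAlg

theorem corollary3p7 {F A : Type*} [Field F] (h2 : ringChar F ≠ 2) (h3 : ringChar F ≠ 3)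
    [NonUnitalRing A] [Module F A] [IsScalarTower F A A] [SMulCommClass F A A]
    [FiniteDimensional F A] (T : A →ₗ[F] A)
    (hT : ∀ x : A, T x * T x * T x - x * x * x ∈ FinDimAlg.commutatorSpace F A) :
    (∀ x : A, T (x * x * x * x) - T x * T x * T x * T x ∈ FinDimAlg.rad F A) ∧
    (∀ e : A, (∀ x : A, e * x = x ∧ x * e = x) → T e = e →
      ∀ x : A, T (x * x) - T x * T x ∈ FinDimAlg.rad F A) := by
  have two_ne : (2 : F) ≠ 0 := Ring.two_ne_zero h2
  have three_ne : (3 : F) ≠ 0 := by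
    intro h
    have hd : ringChar F ∣ 3 := (ringChar.spec F 3).1 (by exact_mod_cast h)
    rcases (Nat.dvd_prime Nat.prime_three).1 hd with h1 | h1
    · exact CharP.ringChar_ne_one h1
    · exact h3 h1
  let K := AlgebraicClosure F
  have two_ne' : (2 : K) ≠ 0 := by
    rw [← map_ofNat (algebraMap F K) 2]; exact (map_ne_zero _).2 two_ne
  have three_ne' : (3 : K) ≠ 0 := by
    rw [← map_ofNat (algebraMap F K) 3]; exact (map_ne_zero _).2 three_ne
  obtain ⟨H4, H2⟩ := FinDimAlg.map_pow_four_and_map_sq_of_isAlgClosed two_ne' three_ne'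
    (T.baseChange K) (FinDimAlg.baseChange_mem_commutatorSpace T
      (FinDimAlg.polarized_mem_commutatorSpace three_ne T hT))
  refine ⟨fun x => FinDimAlg.mem_rad_of_one_tmul_mem_rad (K := K) ?_,
    fun e he hTe x => FinDimAlg.mem_rad_of_one_tmul_mem_rad (K := K) ?_⟩
  · simpa [TensorProduct.tmul_sub] using H4 (TensorProduct.tmul F 1 x)
  · have := H2 (TensorProduct.tmul F 1 e) (fun y => ?_) (by simp [hTe]) (TensorProduct.tmul F 1 x)
    · simpa [TensorProduct.tmul_sub] using this
    · induction y with
      | zero => simp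
      | add y₁ y₂ h₁ h₂ => rw [mul_add, add_mul, h₁.1, h₁.2, h₂.1, h₂.2]; exact ⟨rfl, rfl⟩
      | tmul k y => simp [(he y).1, (he y).2]
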